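/- For Heyting algebras $A$ and $B$ let $A+B$ denote their concatenation, obtained by putting $B$ on top of $A$ and identifying the top element of $A$ with the bottom element of $B$ (in expressions, $\times$ binds more strongly than $+$). Let $Z$ be the Rieger–Nishimura ladder, i.e. the free Heyting algebra on one generator, let $Z_2$ be the two-element Boolean algebra, and put $Z' = Z\times Z_2+Z_2$. For a Heyting algebra $H$ let $s(H)$ be its modal span: the interior algebra whose underlying Boolean algebra is the free Boolean extension of the bounded lattice $H$, with $\Box x=\bigwedge_{i=1}^n(a_i\to b_i)$ (implication of $H$) whenever $x=\bigwedge_{i=1}^n(\neg a_i\vee b_i)$ with $a_i,b_i\in H$. For an interior algebra $K$ let $\mathcal V(K)$ be the variety of interior algebras generated by $K$. An interior algebra $S$ is finitely presentable over a variety $\mathcal M$ of interior algebras if $S\in\mathcal M$ and there are a modal formula $\varphi(p_1,\dots,p_n)$ and elements $a_1,\dots,a_n$ generating $S$ such that $\varphi(a_1,\dots,a_n)=1$ and, for every modal formula $\psi(p_1,\dots,p_n)$ with $\psi(a_1,\dots,a_n)=1$, the formula $\Box\varphi\to\psi$ is valid in every algebra of $\mathcal M$. Theorem. For every non-degenerate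 Heyting algebra $A$, the interior algebra $s(Z')$ is finitely presentable over the variety $\mathcal V\bigl(s(Z\times Z_2+A)\bigr)$. In particular, there are infinite subdirectly irreducible interior algebras $S$ that are finitely presentable over $\mathcal V(S)$: the algebra $S=s(Z')$ is infinite, subdirectly irreducible, and finitely presentable over $\mathcal V(s(Z'))$. -/

import Mathlib

universe u v w

/-! ### Heyting algebras: free algebras, the Rieger–Nishimura ladder, concatenation -/

/-- Terms in the language of Heyting algebras over a set `X` of generators. -/
inductive HeytTerm (X : Type u) : Type u
  | var : X → HeytTerm X
  | bot : HeytTerm X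
  | top : HeytTerm X
  | inf : HeytTerm X → HeytTerm X → HeytTerm X
  | sup : HeytTerm X → HeytTerm X → HeytTerm X
  | imp : HeytTerm X → HeytTerm X → HeytTerm X

/-- The least preorder on terms that satisfies the laws of Heyting algebras, that is,
derivability `s ⊢ t` in intuitionistic propositional logic. -/
inductive HeytTerm.Le {X : Type u} : HeytTerm X → HeytTerm X → Prop
  | refl (a : HeytTerm X) : Le a a
  | trans {a b c : HeytTerm X} : Le a b → Le b c → Le a c
  | bot_le (a : HeytTerm X) : Le bot a
  | le_top (a : HeytTerm X) : Le a top
  | inf_left (a b : HeytTerm X) : Le (inf a b) a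
  | inf_right (a b : HeytTerm X) : Le (inf a b) b
  | le_inf {a b c : HeytTerm X} : Le a b → Le a c → Le a (inf b c)
  | sup_left (a b : HeytTerm X) : Le a (sup a b)
  | sup_right (a b : HeytTerm X) : Le b (sup a b)
  | sup_le {a b c : HeytTerm X} : Le a c → Le b c → Le (sup a b) c
  | imp_intro {a b c : HeytTerm X} : Le (inf a b) c → Le a (imp b c)
  | imp_elim {a b c : HeytTerm X} : Le a (imp b c) → Le (inf a b) c

instance HeytTerm.setoid (X : Type u) : Setoid (HeytTerm X) where
  r s t := HeytTerm.Le s t ∧ HeytTerm.Le t s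
  iseqv := ⟨fun a => ⟨.refl a, .refl a⟩, fun h => ⟨h.2, h.1⟩,
    fun h k => ⟨h.1.trans k.1, k.2.trans h.2⟩⟩

/-- The free Heyting algebra over `X`: terms modulo the laws of Heyting algebras. -/
def FreeHeyting (X : Type u) : Type u := Quotient (HeytTerm.setoid X)

namespace FreeHeyting

variable {X : Type u}

/-- The class of a term. -/
def mk (t : HeytTerm X) : FreeHeyting X := Quotient.mk _ t

/-- The free generators. -/
def of (x : X) : FreeHeyting X := mk (.var x)

instance : LE (FreeHeyting X) where
  le := Quotient.lift₂ HeytTerm.Le fun _ _ _ _ h k =>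
    propext ⟨fun l => h.2.trans (l.trans k.1), fun l => h.1.trans (l.trans k.2)⟩

/-- Implication on classes of terms. -/
def imp : FreeHeyting X → FreeHeyting X → FreeHeyting X :=
  Quotient.map₂ HeytTerm.imp fun _ _ h _ _ k =>
    ⟨.imp_intro (.trans (.le_inf (.inf_left _ _) (.trans (.inf_right _ _) h.2))
        (.trans (.imp_elim (.refl _)) k.1)),
      .imp_intro (.trans (.le_inf (.inf_left _ _) (.trans (.inf_right _ _) h.1))
        (.trans (.imp_elim (.refl _)) k.2))⟩

instance : HeytingAlgebra (FreeHeyting X) where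
  le_refl := by rintro ⟨a⟩; exact .refl a
  le_trans := by rintro ⟨a⟩ ⟨b⟩ ⟨c⟩ h k; exact HeytTerm.Le.trans h k
  le_antisymm := by rintro ⟨a⟩ ⟨b⟩ h k; exact Quotient.sound ⟨h, k⟩
  inf := Quotient.map₂ HeytTerm.inf fun _ _ h _ _ k =>
    ⟨.le_inf (.trans (.inf_left _ _) h.1) (.trans (.inf_right _ _) k.1),
      .le_inf (.trans (.inf_left _ _) h.2) (.trans (.inf_right _ _) k.2)⟩
  sup := Quotient.map₂ HeytTerm.sup fun _ _ h _ _ k =>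
    ⟨.sup_le (.trans h.1 (.sup_left _ _)) (.trans k.1 (.sup_right _ _)),
      .sup_le (.trans h.2 (.sup_left _ _)) (.trans k.2 (.sup_right _ _))⟩
  himp := imp
  compl a := imp a (mk .bot)
  top := mk .top
  bot := mk .bot
  inf_le_left := by rintro ⟨a⟩ ⟨b⟩; exact .inf_left a b
  inf_le_right := by rintro ⟨a⟩ ⟨b⟩; exact .inf_right a b
  le_inf := by rintro ⟨a⟩ ⟨b⟩ ⟨c⟩ h k; exact HeytTerm.Le.le_inf h k
  le_sup_left := by rintro ⟨a⟩ ⟨b⟩; exact .sup_left a b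
  le_sup_right := by rintro ⟨a⟩ ⟨b⟩; exact .sup_right a b
  sup_le := by rintro ⟨a⟩ ⟨b⟩ ⟨c⟩ h k; exact HeytTerm.Le.sup_le h k
  le_top := by rintro ⟨a⟩; exact .le_top a
  bot_le := by rintro ⟨a⟩; exact .bot_le a
  le_himp_iff := by
    rintro ⟨a⟩ ⟨b⟩ ⟨c⟩
    exact ⟨fun h => HeytTerm.Le.imp_elim h, fun h => HeytTerm.Le.imp_intro h⟩
  himp_bot := by rintro ⟨a⟩; rfl

end FreeHeyting

/-- The Rieger–Nishimura ladder `Z`: the free Heyting algebra on one generator. -/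
abbrev RiegerNishimura : Type := FreeHeyting Unit

/-- The concatenation `A + B`: the algebra `B` is put on top of `A`, and the top of `A` is
identified with the bottom of `B`. An element `a` of `A` is represented by `(a, ⊥)` and an
element `b` of `B` by `(⊤, b)`; the order is componentwise, so that every element of `A` lies
below every element of `B`. -/
def Concat (A : Type u) (B : Type v) [HeytingAlgebra A] [HeytingAlgebra B] : Type (max u v) :=
  {x : A × B // x.1 = ⊤ ∨ x.2 = ⊥}

namespace Concat

variable {A : Type u} {B : Type v} [HeytingAlgebra A] [HeytingAlgebra B]

/-- The copy of `A` in `A + B`. -/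
def inl (a : A) : Concat A B := ⟨(a, ⊥), Or.inr rfl⟩

/-- The copy of `B` in `A + B`. -/
def inr (b : B) : Concat A B := ⟨(⊤, b), Or.inl rfl⟩

instance : PartialOrder (Concat A B) := inferInstanceAs (PartialOrder {x : A × B // x.1 = ⊤ ∨ x.2 = ⊥})

instance : Lattice (Concat A B) where
  inf x y := ⟨x.1 ⊓ y.1, by
    rw [Prod.fst_inf, Prod.snd_inf]
    rcases x.2 with h | h <;> rcases y.2 with k | k <;> rw [h, k] <;> simp⟩
  sup x y := ⟨x.1 ⊔ y.1, by
    rw [Prod.fst_sup, Prod.snd_sup]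
    rcases x.2 with h | h <;> rcases y.2 with k | k <;> rw [h, k] <;> simp⟩
  inf_le_left x y := (inf_le_left : x.1 ⊓ y.1 ≤ x.1)
  inf_le_right x y := (inf_le_right : x.1 ⊓ y.1 ≤ y.1)
  le_inf x y z h k := (_root_.le_inf h k : x.1 ≤ y.1 ⊓ z.1)
  le_sup_left x y := (le_sup_left : x.1 ≤ x.1 ⊔ y.1)
  le_sup_right x y := (le_sup_right : y.1 ≤ x.1 ⊔ y.1)
  sup_le x y z h k := (_root_.sup_le h k : x.1 ⊔ y.1 ≤ z.1)

instance : BoundedOrder (Concat A B) where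
  top := ⟨(⊤, ⊤), Or.inl rfl⟩
  bot := ⟨(⊥, ⊥), Or.inr rfl⟩
  le_top x := (le_top : x.1 ≤ ⊤)
  bot_le x := (bot_le : ⊥ ≤ x.1)

open scoped Classical in
/-- Relative pseudo-complement in `A + B`. -/
noncomputable def himp (x y : Concat A B) : Concat A B :=
  if x.1.1 ≤ y.1.1 then inr (x.1.2 ⇨ y.1.2) else inl (x.1.1 ⇨ y.1.1)

theorem le_himp (x y z : Concat A B) : x ≤ himp y z ↔ x ⊓ y ≤ z := by
  have key : x ⊓ y ≤ z ↔ (x.1.1 ⊓ y.1.1 ≤ z.1.1 ∧ x.1.2 ⊓ y.1.2 ≤ z.1.2) := Iff.rfl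
  rw [key]
  unfold himp
  split_ifs with h
  · change (x.1.1 ≤ ⊤ ∧ x.1.2 ≤ y.1.2 ⇨ z.1.2) ↔ _
    simp [le_himp_iff, inf_le_of_right_le h]
  · change (x.1.1 ≤ y.1.1 ⇨ z.1.1 ∧ x.1.2 ≤ ⊥) ↔ _
    rw [le_himp_iff]
    refine and_congr_right fun hac => ?_
    have hb : x.1.2 = ⊥ := by
      rcases x.2 with hx | hx
      · rw [hx, top_inf_eq] at hac
        exact absurd hac h
      · exact hx
    simp [hb]

noncomputable instance : HeytingAlgebra (Concat A B) where
  himp := himp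
  compl x := himp x ⊥
  le_top := fun _ => le_top
  bot_le := fun _ => bot_le
  le_himp_iff := le_himp
  himp_bot _ := rfl

end Concat

/-- The algebra `Z × Z₂ + A`, where `Z₂` is the two-element Boolean algebra. -/
abbrev ZStar (A : Type u) [HeytingAlgebra A] : Type u := Concat (RiegerNishimura × Bool) A

/-- The algebra `Z' = Z × Z₂ + Z₂`. -/
abbrev ZPrime : Type := ZStar Bool

/-! ### Interior algebras, modal formulas, varieties, finite presentability -/

/-- Interior algebras (topological Boolean algebras, `S4`-algebras). -/
class InteriorAlgebra (S : Type u) extends BooleanAlgebra S where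
  box : S → S
  box_top : box ⊤ = ⊤
  box_inf : ∀ a b : S, box (a ⊓ b) = box a ⊓ box b
  box_le : ∀ a : S, box a ≤ a
  box_box : ∀ a : S, box (box a) = box a

/-- Modal formulas (terms in the signature of interior algebras) with variables in `X`. -/
inductive ModalFormula (X : Type u) : Type u
  | var : X → ModalFormula X
  | and : ModalFormula X → ModalFormula X → ModalFormula X
  | or : ModalFormula X → ModalFormula X → ModalFormula X
  | imp : ModalFormula X → ModalFormula X → ModalFormula X
  | neg : ModalFormula X → ModalFormula X
  | box : ModalFormula X → ModalFormula X

/-- The value of a formula in an interior algebra under a valuation. -/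
def ModalFormula.eval {X : Type u} {S : Type v} [InteriorAlgebra S] (a : X → S) :
    ModalFormula X → S
  | var x => a x
  | and φ ψ => eval a φ ⊓ eval a ψ
  | or φ ψ => eval a φ ⊔ eval a ψ
  | imp φ ψ => eval a φ ⇨ eval a ψ
  | neg φ => (eval a φ)ᶜ
  | box φ => InteriorAlgebra.box (eval a φ)

/-- A variety of interior algebras, given by a set of identities `s ≈ t`. -/
structure InteriorVariety where
  identities : Set (ModalFormula ℕ × ModalFormula ℕ)

namespace InteriorVariety

/-- `S` belongs to the variety. -/
def Mem (V : InteriorVariety) (S : Type u) [InteriorAlgebra S] : Prop :=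
  ∀ e ∈ V.identities, ∀ a : ℕ → S, e.1.eval a = e.2.eval a

/-- The variety generated by `K`: the smallest variety that contains `K`, namely the class of
all interior algebras that satisfy every identity of `K`. -/
def generatedBy (K : Type u) [InteriorAlgebra K] : InteriorVariety where
  identities := {e | ∀ a : ℕ → K, e.1.eval a = e.2.eval a}

theorem mem_generatedBy (K : Type u) [InteriorAlgebra K] : (generatedBy K).Mem K :=
  fun _ he => he

theorem generatedBy_least (K : Type u) [InteriorAlgebra K] (V : InteriorVariety) (hK : V.Mem K)
    (S : Type v) [InteriorAlgebra S] (hS : (generatedBy K).Mem S) : V.Mem S :=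
  fun e he => hS e (hK e he)

/-- `⊢_V φ`: the formula `φ` is valid in every algebra of the variety. -/
def Valid (V : InteriorVariety) {X : Type u} (φ : ModalFormula X) : Prop :=
  ∀ (S : Type w) [InteriorAlgebra S], V.Mem S → ∀ a : X → S, φ.eval a = ⊤

end InteriorVariety

/-- The family `a` generates the interior algebra `S`: the only subalgebra that contains all
`a i` is `S`. -/
def GeneratesInterior {S : Type u} [InteriorAlgebra S] {X : Type v} (a : X → S) : Prop :=
  ∀ T : Set S, (∀ i, a i ∈ T) →
    (∀ x ∈ T, ∀ y ∈ T, x ⊓ y ∈ T) → (∀ x ∈ T, ∀ y ∈ T, x ⊔ y ∈ T) →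
    (∀ x ∈ T, ∀ y ∈ T, x ⇨ y ∈ T) → (∀ x ∈ T, xᶜ ∈ T) →
    (∀ x ∈ T, InteriorAlgebra.box x ∈ T) → T = Set.univ

/-- The formula `φ(p₁, …, pₙ)` together with the valuation `pᵢ ↦ aᵢ` defines the algebra `S`
over the variety `V`. -/
def DefinesInterior (V : InteriorVariety) {S : Type u} [InteriorAlgebra S] {n : ℕ}
    (φ : ModalFormula (Fin n)) (a : Fin n → S) : Prop :=
  GeneratesInterior a ∧ φ.eval a = ⊤ ∧
    ∀ ψ : ModalFormula (Fin n), ψ.eval a = ⊤ →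
      InteriorVariety.Valid.{0, w} V (ModalFormula.imp (ModalFormula.box φ) ψ)

/-- `S` is finitely presentable over the variety `V`: it belongs to `V` and is defined over `V`
by some formula and valuation. -/
def FinitelyPresentableOver (V : InteriorVariety) (S : Type u) [InteriorAlgebra S] : Prop :=
  V.Mem S ∧ ∃ (n : ℕ) (φ : ModalFormula (Fin n)) (a : Fin n → S), DefinesInterior.{u, w} V φ a

/-- Congruences of an interior algebra. -/
structure IsInteriorCongruence {S : Type u} [InteriorAlgebra S] (r : S → S → Prop) : Prop where
  equivalence : Equivalence r
  inf : ∀ {a b c d : S}, r a b → r c d → r (a ⊓ c) (b ⊓ d)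
  sup : ∀ {a b c d : S}, r a b → r c d → r (a ⊔ c) (b ⊔ d)
  himp : ∀ {a b c d : S}, r a b → r c d → r (a ⇨ c) (b ⇨ d)
  compl : ∀ {a b : S}, r a b → r aᶜ bᶜ
  box : ∀ {a b : S}, r a b → r (InteriorAlgebra.box a) (InteriorAlgebra.box b)

/-- `S` is subdirectly irreducible: it has a least congruence among those different from
equality, that is, there are two distinct elements that are identified by every congruence
different from equality. -/
def IsSubdirectlyIrreducible (S : Type u) [InteriorAlgebra S] : Prop :=
  ∃ a b : S, a ≠ b ∧
    ∀ r : S → S → Prop, IsInteriorCongruence r → (∃ x y, x ≠ y ∧ r x y) → r a b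

/-! ### The modal span of a Heyting algebra -/

/-- Boolean terms over the elements of `H`. -/
inductive BoolTerm (H : Type u) : Type u
  | of : H → BoolTerm H
  | bot : BoolTerm H
  | top : BoolTerm H
  | inf : BoolTerm H → BoolTerm H → BoolTerm H
  | sup : BoolTerm H → BoolTerm H → BoolTerm H
  | compl : BoolTerm H → BoolTerm H

/-- The least preorder on Boolean terms over `H` that satisfies the laws of Boolean algebras and
makes the inclusion of `H` a homomorphism of bounded lattices. -/
inductive BoolTerm.Le {H : Type u} [HeytingAlgebra H] : BoolTerm H → BoolTerm H → Prop
  | refl (a : BoolTerm H) : Le a a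
  | trans {a b c : BoolTerm H} : Le a b → Le b c → Le a c
  | bot_le (a : BoolTerm H) : Le bot a
  | le_top (a : BoolTerm H) : Le a top
  | inf_left (a b : BoolTerm H) : Le (inf a b) a
  | inf_right (a b : BoolTerm H) : Le (inf a b) b
  | le_inf {a b c : BoolTerm H} : Le a b → Le a c → Le a (inf b c)
  | sup_left (a b : BoolTerm H) : Le a (sup a b)
  | sup_right (a b : BoolTerm H) : Le b (sup a b)
  | sup_le {a b c : BoolTerm H} : Le a c → Le b c → Le (sup a b) c
  | distrib (a b c : BoolTerm H) : Le (inf (sup a b) (sup a c)) (sup a (inf b c))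
  | inf_compl (a : BoolTerm H) : Le (inf a (compl a)) bot
  | sup_compl (a : BoolTerm H) : Le top (sup a (compl a))
  | compl_anti {a b : BoolTerm H} : Le a b → Le (compl b) (compl a)
  | of_bot : Le (of ⊥) bot
  | of_top : Le top (of ⊤)
  | of_mono {a b : H} : a ≤ b → Le (of a) (of b)
  | of_inf (a b : H) : Le (inf (of a) (of b)) (of (a ⊓ b))
  | of_sup (a b : H) : Le (of (a ⊔ b)) (sup (of a) (of b))

instance BoolTerm.setoid (H : Type u) [HeytingAlgebra H] : Setoid (BoolTerm H) where
  r s t := BoolTerm.Le s t ∧ BoolTerm.Le t s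
  iseqv := ⟨fun a => ⟨.refl a, .refl a⟩, fun h => ⟨h.2, h.1⟩,
    fun h k => ⟨h.1.trans k.1, k.2.trans h.2⟩⟩

/-- The modal span `s(H)`. Its carrier is the free Boolean extension of the bounded lattice `H`:
Boolean terms over `H` modulo the laws of Boolean algebras and the lattice relations of `H`. -/
def ModalSpan (H : Type u) [HeytingAlgebra H] : Type u := Quotient (BoolTerm.setoid H)

namespace ModalSpan

variable {H : Type u} [HeytingAlgebra H]

/-- The class of a term. -/
def mk (t : BoolTerm H) : ModalSpan H := Quotient.mk _ t

/-- The inclusion of `H` into its free Boolean extension. -/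
def of (a : H) : ModalSpan H := mk (.of a)

instance : LE (ModalSpan H) where
  le := Quotient.lift₂ BoolTerm.Le fun _ _ _ _ h k =>
    propext ⟨fun l => h.2.trans (l.trans k.1), fun l => h.1.trans (l.trans k.2)⟩

instance : BooleanAlgebra (ModalSpan H) where
  le_refl := by rintro ⟨a⟩; exact .refl a
  le_trans := by rintro ⟨a⟩ ⟨b⟩ ⟨c⟩ h k; exact BoolTerm.Le.trans h k
  le_antisymm := by rintro ⟨a⟩ ⟨b⟩ h k; exact Quotient.sound ⟨h, k⟩
  inf := Quotient.map₂ BoolTerm.inf fun _ _ h _ _ k =>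
    ⟨.le_inf (.trans (.inf_left _ _) h.1) (.trans (.inf_right _ _) k.1),
      .le_inf (.trans (.inf_left _ _) h.2) (.trans (.inf_right _ _) k.2)⟩
  sup := Quotient.map₂ BoolTerm.sup fun _ _ h _ _ k =>
    ⟨.sup_le (.trans h.1 (.sup_left _ _)) (.trans k.1 (.sup_right _ _)),
      .sup_le (.trans h.2 (.sup_left _ _)) (.trans k.2 (.sup_right _ _))⟩
  compl := Quotient.map BoolTerm.compl fun _ _ h => ⟨.compl_anti h.2, .compl_anti h.1⟩
  top := mk .top
  bot := mk .bot
  inf_le_left := by rintro ⟨a⟩ ⟨b⟩; exact .inf_left a b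
  inf_le_right := by rintro ⟨a⟩ ⟨b⟩; exact .inf_right a b
  le_inf := by rintro ⟨a⟩ ⟨b⟩ ⟨c⟩ h k; exact BoolTerm.Le.le_inf h k
  le_sup_left := by rintro ⟨a⟩ ⟨b⟩; exact .sup_left a b
  le_sup_right := by rintro ⟨a⟩ ⟨b⟩; exact .sup_right a b
  sup_le := by rintro ⟨a⟩ ⟨b⟩ ⟨c⟩ h k; exact BoolTerm.Le.sup_le h k
  le_top := by rintro ⟨a⟩; exact .le_top a
  bot_le := by rintro ⟨a⟩; exact .bot_le a
  le_sup_inf := by rintro ⟨a⟩ ⟨b⟩ ⟨c⟩; exact .distrib a b c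
  inf_compl_le_bot := by rintro ⟨a⟩; exact .inf_compl a
  top_le_sup_compl := by rintro ⟨a⟩; exact .sup_compl a
  sdiff_eq := fun _ _ => rfl
  himp_eq := fun _ _ => rfl

theorem of_mono {a b : H} (h : a ≤ b) : of a ≤ of b := BoolTerm.Le.of_mono h

theorem of_bot : of (⊥ : H) = ⊥ := le_bot_iff.1 BoolTerm.Le.of_bot

theorem of_top : of (⊤ : H) = ⊤ := top_le_iff.1 BoolTerm.Le.of_top

theorem of_inf (a b : H) : of (a ⊓ b) = of a ⊓ of b :=
  le_antisymm (le_inf (of_mono inf_le_left) (of_mono inf_le_right)) (BoolTerm.Le.of_inf a b)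

theorem of_sup (a b : H) : of (a ⊔ b) = of a ⊔ of b :=
  le_antisymm (BoolTerm.Le.of_sup a b) (sup_le (of_mono le_sup_left) (of_mono le_sup_right))

theorem induction {P : ModalSpan H → Prop} (h_of : ∀ a, P (of a))
    (h_inf : ∀ x y, P x → P y → P (x ⊓ y)) (h_compl : ∀ x, P x → P xᶜ) (x : ModalSpan H) :
    P x := by
  obtain ⟨t⟩ := x
  change P (mk t)
  induction t with
  | of a => exact h_of a
  | bot => exact (of_bot (H := H) ▸ h_of ⊥ : P ⊥)
  | top => exact (of_top (H := H) ▸ h_of ⊤ : P ⊤)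
  | inf a b ha hb => exact h_inf _ _ ha hb
  | sup a b ha hb =>
    have := h_compl _ (h_inf _ _ (h_compl _ ha) (h_compl _ hb))
    rw [compl_inf, compl_compl, compl_compl] at this
    exact this
  | compl a ha => exact h_compl _ ha

/-- The element `⋀ᵢ (¬ aᵢ ∨ bᵢ)` of the free Boolean extension. -/
def cnf (l : List (H × H)) : ModalSpan H :=
  (l.map fun p => (of p.1)ᶜ ⊔ of p.2).foldr (· ⊓ ·) ⊤

/-- The element `⋀ᵢ (aᵢ → bᵢ)` of `H`. -/
def impInf (l : List (H × H)) : H :=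
  (l.map fun p => p.1 ⇨ p.2).foldr (· ⊓ ·) ⊤

theorem cnf_append (l m : List (H × H)) : cnf (l ++ m) = cnf l ⊓ cnf m := by
  induction l with
  | nil => simp [cnf]
  | cons p l ih =>
    have h : cnf (p :: (l ++ m)) = ((of p.1)ᶜ ⊔ of p.2) ⊓ cnf (l ++ m) := rfl
    have h' : cnf (p :: l) = ((of p.1)ᶜ ⊔ of p.2) ⊓ cnf l := rfl
    rw [List.cons_append, h, h', ih, inf_assoc]

theorem exists_cnf_sup_one (p : H × H) (m : List (H × H)) :
    ∃ k, cnf k = ((of p.1)ᶜ ⊔ of p.2) ⊔ cnf m := by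
  induction m with
  | nil => exact ⟨[], by simp [cnf]⟩
  | cons q m ih =>
    obtain ⟨k, hk⟩ := ih
    refine ⟨(p.1 ⊓ q.1, p.2 ⊔ q.2) :: k, ?_⟩
    have h : cnf (q :: m) = ((of q.1)ᶜ ⊔ of q.2) ⊓ cnf m := rfl
    have h' : cnf ((p.1 ⊓ q.1, p.2 ⊔ q.2) :: k) =
      ((of (p.1 ⊓ q.1))ᶜ ⊔ of (p.2 ⊔ q.2)) ⊓ cnf k := rfl
    rw [h, h', hk, of_inf, of_sup, compl_inf, sup_inf_left, sup_sup_sup_comm]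

theorem exists_cnf_sup (l m : List (H × H)) : ∃ k, cnf k = cnf l ⊔ cnf m := by
  induction l with
  | nil => exact ⟨[], by simp [cnf]⟩
  | cons p l ih =>
    obtain ⟨k, hk⟩ := ih
    obtain ⟨k', hk'⟩ := exists_cnf_sup_one p m
    refine ⟨k' ++ k, ?_⟩
    have h : cnf (p :: l) = ((of p.1)ᶜ ⊔ of p.2) ⊓ cnf l := rfl
    rw [cnf_append, hk, hk', h, sup_inf_right]

theorem exists_cnf_compl (l : List (H × H)) : ∃ k, cnf k = (cnf l)ᶜ := by
  induction l with
  | nil => exact ⟨[(⊤, ⊥)], by simp [cnf, of_top, of_bot]⟩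
  | cons p l ih =>
    obtain ⟨k, hk⟩ := ih
    obtain ⟨k', hk'⟩ := exists_cnf_sup [(⊤, p.1), (p.2, ⊥)] k
    refine ⟨k', ?_⟩
    have h : cnf (p :: l) = ((of p.1)ᶜ ⊔ of p.2) ⊓ cnf l := rfl
    rw [hk', hk, h, compl_inf, compl_sup, compl_compl]
    simp [cnf, of_top, of_bot]

/-- Every element of the free Boolean extension has the form `⋀ᵢ (¬ aᵢ ∨ bᵢ)`. -/
theorem exists_cnf (x : ModalSpan H) : ∃ l, cnf l = x := by
  refine induction (P := fun x => ∃ l, cnf l = x) (fun a => ⟨[(⊤, a)], by simp [cnf, of_top]⟩) ?_ ?_ x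
  · rintro _ _ ⟨l, rfl⟩ ⟨m, rfl⟩
    exact ⟨l ++ m, cnf_append l m⟩
  · rintro _ ⟨l, rfl⟩
    exact exists_cnf_compl l

/-- A prime ideal of `H` yields a two-valued interpretation of Boolean terms. -/
def holds (J : Set H) : BoolTerm H → Prop
  | .of a => a ∉ J
  | .bot => False
  | .top => True
  | .inf s t => holds J s ∧ holds J t
  | .sup s t => holds J s ∨ holds J t
  | .compl s => ¬ holds J s

theorem holds_mono (J : Order.Ideal H) (hJ : J.IsPrime) {s t : BoolTerm H}
    (h : BoolTerm.Le s t) : holds (J : Set H) s → holds (J : Set H) t := by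
  induction h with
  | of_bot => exact fun h => h J.bot_mem
  | of_top => exact fun _ => hJ.toIsProper.top_notMem
  | of_mono h => exact fun h' k => h' (J.lower h k)
  | of_inf a b => exact fun h k => (hJ.mem_or_mem k).elim h.1 h.2
  | of_sup a b =>
    intro h
    by_contra k
    simp only [holds, not_or, not_not] at k
    exact h (J.sup_mem k.1 k.2)
  | trans _ _ h k => exact fun l => k (h l)
  | refl => exact id
  | compl_anti _ h => exact fun k l => k (h l)
  | _ => simp only [holds] at *; tauto

/-- The inclusion of `H` into its free Boolean extension is an order embedding. -/
theorem of_le_of {a b : H} : of a ≤ of b ↔ a ≤ b := by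
  refine ⟨fun h => ?_, of_mono⟩
  by_contra hab
  have hd : Disjoint ((Order.PFilter.principal a : Order.PFilter H) : Set H)
      ((Order.Ideal.principal b : Order.Ideal H) : Set H) := by
    rw [Set.disjoint_left]
    intro x hx hx'
    exact hab (le_trans hx hx')
  obtain ⟨J, hJ, hbJ, haJ⟩ := DistribLattice.prime_ideal_of_disjoint_filter_ideal hd
  have ha : a ∉ J := fun k => Set.disjoint_left.1 haJ (show a ≤ a from le_rfl) k
  exact holds_mono J hJ h ha (hbJ (show b ≤ b from le_rfl))

theorem of_le_cnf (h : H) (l : List (H × H)) : of h ≤ cnf l ↔ h ≤ impInf l := by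
  induction l with
  | nil => simp [cnf, impInf]
  | cons p l ih =>
    have h₁ : cnf (p :: l) = ((of p.1)ᶜ ⊔ of p.2) ⊓ cnf l := rfl
    have h₂ : impInf (p :: l) = (p.1 ⇨ p.2) ⊓ impInf l := rfl
    rw [h₁, h₂, le_inf_iff, le_inf_iff, ih, le_himp_iff, ← of_le_of (a := h ⊓ p.1), of_inf, sup_comm, ← himp_eq,
      le_himp_iff]

/-- The interior operation: if `x = ⋀ᵢ (¬ aᵢ ∨ bᵢ)` then `□ x = ⋀ᵢ (aᵢ → bᵢ)`. -/
noncomputable def box (x : ModalSpan H) : ModalSpan H := of (impInf (exists_cnf x).choose)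

theorem of_le_box (h : H) (x : ModalSpan H) : of h ≤ box x ↔ of h ≤ x := by
  conv_rhs => rw [← (exists_cnf x).choose_spec]
  rw [box, of_le_of, of_le_cnf]

/-- The interior operation does not depend on the chosen representation. -/
theorem box_cnf (l : List (H × H)) : box (cnf l) = of (impInf l) := by
  refine le_antisymm ?_ ?_
  · have h := (of_le_box (impInf (exists_cnf (cnf l)).choose) (cnf l)).1 le_rfl
    exact of_mono ((of_le_cnf _ _).1 h)
  · exact (of_le_box _ _).2 ((of_le_cnf _ _).2 le_rfl)

theorem box_le_self (x : ModalSpan H) : box x ≤ x :=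
  (of_le_box (impInf (exists_cnf x).choose) x).1 le_rfl

theorem box_mono {x y : ModalSpan H} (h : x ≤ y) : box x ≤ box y :=
  (of_le_box (impInf (exists_cnf x).choose) y).2 ((box_le_self x).trans h)

theorem box_of (a : H) : box (of a) = of a :=
  le_antisymm (box_le_self _) ((of_le_box a _).2 le_rfl)

noncomputable instance : InteriorAlgebra (ModalSpan H) where
  box := box
  box_top := by rw [← of_top, box_of]
  box_inf x y := by
    refine le_antisymm (le_inf (box_mono inf_le_left) (box_mono inf_le_right)) ?_
    have h : box x ⊓ box y =
        of (impInf (exists_cnf x).choose ⊓ impInf (exists_cnf y).choose) := by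
      rw [of_inf]; rfl
    rw [h, of_le_box, ← h]
    exact inf_le_inf (box_le_self x) (box_le_self y)
  box_le := box_le_self
  box_box x := box_of _

end ModalSpan

/-!
Let `g` be the generator of `Z`. It is the only element of `Z` that is neither regular nor dense,
so `g` is also the only element at which the Nishimura term `¬¬x ∨ (¬¬x → x)` does not have the
value `⊤`. The algebra `Z' = Z × Z₂ + Z₂` is generated by `p = (g, 0)` and `q = (1, 0)`, and these
satisfy `p ≤ q`, `¬¬q = q` and `(q → (¬¬p ∨ (¬¬p → p))) ≤ q ∨ ¬q`.

These three relations present `Z'`. A quotient of `Z × Z₂ + A` by a principal filter is the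
relative algebra below some `c`; let `p` and `q` be elements of it that satisfy the relations. If
`q ∨ ¬q` is the unit, then the relative algebra is the product of its parts below `q` and below
`¬q`, and the freeness of `Z` gives a homomorphism from `Z × Z₂` to it. Otherwise the Nishimura
term is not `⊤` at `p`, and this forces `p` and `q` to be the images of the generators. In both
cases the assignment of the generators extends to a homomorphism on `Z'`. Since the open elements
of `s(H)` are the elements of `H`, the relations can be written as a modal formula, and the
extension property is exactly the entailment required of a presentation.
-/

/-! ### Heyting homomorphisms -/

/-- The value of a Heyting term under a valuation of its variables. -/
def HeytTerm.eval {X : Type u} {L : Type v} [HeytingAlgebra L] (a : X → L) : HeytTerm X → L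
  | var x => a x
  | bot => ⊥
  | top => ⊤
  | inf s t => eval a s ⊓ eval a t
  | sup s t => eval a s ⊔ eval a t
  | imp s t => eval a s ⇨ eval a t

theorem HeytTerm.Le.eval_le {X : Type u} {L : Type v} [HeytingAlgebra L] (a : X → L)
    {s t : HeytTerm X} (h : HeytTerm.Le s t) : s.eval a ≤ t.eval a := by
  induction h with
  | refl => exact le_rfl
  | trans _ _ h k => exact h.trans k
  | bot_le => exact _root_.bot_le
  | le_top => exact _root_.le_top
  | inf_left => exact inf_le_left
  | inf_right => exact inf_le_right
  | le_inf _ _ h k => exact _root_.le_inf h k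
  | sup_left => exact le_sup_left
  | sup_right => exact le_sup_right
  | sup_le _ _ h k => exact _root_.sup_le h k
  | imp_intro _ h => exact le_himp_iff.2 h
  | imp_elim _ h => exact le_himp_iff.1 h

namespace FreeHeyting

variable {X : Type u} {L : Type v} [HeytingAlgebra L]

/-- The unique homomorphism out of the free Heyting algebra that extends a valuation. -/
def lift (a : X → L) : HeytingHom (FreeHeyting X) L where
  toFun := Quotient.lift (HeytTerm.eval a) fun _ _ h =>
    le_antisymm (h.1.eval_le a) (h.2.eval_le a)
  map_sup' := by rintro ⟨s⟩ ⟨t⟩; rfl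
  map_inf' := by rintro ⟨s⟩ ⟨t⟩; rfl
  map_bot' := rfl
  map_himp' := by rintro ⟨s⟩ ⟨t⟩; rfl

@[elab_as_elim]
theorem induction {P : FreeHeyting X → Prop} (of : ∀ x, P (of x)) (bot : P ⊥)
    (inf : ∀ x y, P x → P y → P (x ⊓ y)) (sup : ∀ x y, P x → P y → P (x ⊔ y))
    (himp : ∀ x y, P x → P y → P (x ⇨ y)) (x : FreeHeyting X) : P x := by
  obtain ⟨t⟩ := x
  change P (mk t)
  induction t with
  | var x => exact of x
  | bot => exact bot
  | top => exact (himp_self (a := (⊥ : FreeHeyting X)) ▸ himp ⊥ ⊥ bot bot : P ⊤)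
  | inf s t hs ht => exact inf _ _ hs ht
  | sup s t hs ht => exact sup _ _ hs ht
  | imp s t hs ht => exact himp _ _ hs ht

end FreeHeyting

/-- The homomorphism from the two-element Boolean algebra to a Heyting algebra. -/
def boolHom (L : Type u) [HeytingAlgebra L] : HeytingHom Bool L where
  toFun i := bif i then ⊤ else ⊥
  map_sup' i j := by cases i <;> cases j <;> simp
  map_inf' i j := by cases i <;> cases j <;> simp
  map_bot' := rfl
  map_himp' i j := by
    cases i <;> cases j
    · exact himp_self.symm
    · exact himp_top.symm
    · exact top_himp.symm
    · exact himp_self.symm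

theorem boolHom_injective {L : Type u} [HeytingAlgebra L] [Nontrivial L] :
    Function.Injective (boolHom L) := by
  intro i j h
  cases i <;> cases j <;> first | rfl | exact absurd h bot_ne_top | exact absurd h top_ne_bot

theorem himp_inf_eq_himp_inf_inf {L : Type u} [GeneralizedHeytingAlgebra L] (x y c : L) :
    (x ⇨ y) ⊓ c = ((x ⊓ c) ⇨ (y ⊓ c)) ⊓ c := by
  rw [himp_inf_distrib, himp_eq_top_iff.2 inf_le_right, inf_top_eq, inf_comm x, ← himp_himp,
    himp_inf_self]

/-- The relative algebra below `c`, which is the quotient of `H` by the principal filter of `c`. -/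
instance heytingAlgebraIic {H : Type u} [HeytingAlgebra H] (c : H) :
    HeytingAlgebra (Set.Iic c) where
  himp x y := ⟨(x.1 ⇨ y.1) ⊓ c, inf_le_right⟩
  compl x := ⟨x.1ᶜ ⊓ c, inf_le_right⟩
  le_top _ := le_top
  bot_le _ := bot_le
  le_himp_iff x y z := by
    change x.1 ≤ (y.1 ⇨ z.1) ⊓ c ↔ x.1 ⊓ y.1 ≤ z.1
    rw [le_inf_iff, le_himp_iff]
    exact and_iff_left x.2
  himp_bot x := Subtype.ext (congrArg (· ⊓ c) (himp_bot x.1))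

section Relativize

variable {H : Type u} [HeytingAlgebra H] {c : H}

/-- The quotient homomorphism from a Heyting algebra to its relative algebra below `c`. -/
def relativize (c : H) : HeytingHom H (Set.Iic c) where
  toFun x := ⟨x ⊓ c, inf_le_right⟩
  map_sup' x y := Subtype.ext (inf_sup_right x y c)
  map_inf' x y := Subtype.ext (inf_inf_distrib_right x y c)
  map_bot' := Subtype.ext (bot_inf_eq c)
  map_himp' x y := Subtype.ext (himp_inf_eq_himp_inf_inf x y c)

theorem relativize_coe (x : Set.Iic c) : relativize c x.1 = x := Subtype.ext (inf_eq_left.2 x.2)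

theorem compl_eq_relativize (x : Set.Iic c) : xᶜ = relativize c x.1ᶜ := rfl

theorem relativize_eq_top_iff {x : H} : relativize c x = ⊤ ↔ c ≤ x :=
  Subtype.ext_iff.trans inf_eq_right

end Relativize

theorem eq_of_codisjoint_of_inf_eq {L : Type u} [DistribLattice L] [OrderTop L] {a b x y : L}
    (h : Codisjoint a b) (ha : x ⊓ a = y ⊓ a) (hb : x ⊓ b = y ⊓ b) : x = y := by
  rw [← inf_top_eq x, ← inf_top_eq y, ← h.eq_top, inf_sup_left, inf_sup_left, ha, hb]

theorem inf_sup_inf_inf_left {L : Type u} [DistribLattice L] [OrderBot L] {a b : L}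
    (h : Disjoint a b) (s t : L) : (s ⊓ a ⊔ t ⊓ b) ⊓ a = s ⊓ a := by
  rw [inf_sup_right, inf_assoc, inf_idem, inf_assoc, h.symm.eq_bot, inf_bot_eq, sup_bot_eq]

theorem inf_sup_inf_inf_right {L : Type u} [DistribLattice L] [OrderBot L] {a b : L}
    (h : Disjoint a b) (s t : L) : (s ⊓ a ⊔ t ⊓ b) ⊓ b = t ⊓ b := by
  rw [sup_comm, inf_sup_inf_inf_left h.symm]

/-- Homomorphisms `f` and `g` into `L` and a complemented pair `a`, `b` of elements of `L` give a
homomorphism out of the product that is `f` below `a` and `g` below `b`. -/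
def splitHom {L : Type u} {H₁ : Type v} {H₂ : Type w} [HeytingAlgebra L] [HeytingAlgebra H₁]
    [HeytingAlgebra H₂] {a b : L} (f : HeytingHom H₁ L) (g : HeytingHom H₂ L)
    (h : IsCompl a b) : HeytingHom (H₁ × H₂) L where
  toFun x := f x.1 ⊓ a ⊔ g x.2 ⊓ b
  map_sup' x y := by
    simp only [Prod.fst_sup, Prod.snd_sup, map_sup, inf_sup_right]
    exact sup_sup_sup_comm _ _ _ _
  map_inf' x y := by
    apply eq_of_codisjoint_of_inf_eq h.codisjoint
    · rw [inf_sup_inf_inf_left h.disjoint, inf_inf_distrib_right, inf_sup_inf_inf_left h.disjoint,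
        inf_sup_inf_inf_left h.disjoint, ← inf_inf_distrib_right, ← map_inf, Prod.fst_inf]
    · rw [inf_sup_inf_inf_right h.disjoint, inf_inf_distrib_right,
        inf_sup_inf_inf_right h.disjoint, inf_sup_inf_inf_right h.disjoint,
        ← inf_inf_distrib_right, ← map_inf, Prod.snd_inf]
  map_bot' := by simp
  map_himp' x y := by
    apply eq_of_codisjoint_of_inf_eq h.codisjoint
    · rw [inf_sup_inf_inf_left h.disjoint, himp_inf_eq_himp_inf_inf,
        inf_sup_inf_inf_left h.disjoint, inf_sup_inf_inf_left h.disjoint,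
        ← himp_inf_eq_himp_inf_inf, ← map_himp, fst_himp]
    · rw [inf_sup_inf_inf_right h.disjoint, himp_inf_eq_himp_inf_inf,
        inf_sup_inf_inf_right h.disjoint, inf_sup_inf_inf_right h.disjoint,
        ← himp_inf_eq_himp_inf_inf, ← map_himp, snd_himp]

/-! ### Concatenation -/

namespace Concat

variable {A : Type u} {B : Type v} {C : Type w} [HeytingAlgebra A] [HeytingAlgebra B]
  [HeytingAlgebra C]

theorem himp_of_le {x y : Concat A B} (h : x.1.1 ≤ y.1.1) : x ⇨ y = inr (x.1.2 ⇨ y.1.2) :=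
  if_pos h

theorem himp_of_not_le {x y : Concat A B} (h : ¬ x.1.1 ≤ y.1.1) : x ⇨ y = inl (x.1.1 ⇨ y.1.1) :=
  if_neg h

/-- The quotient homomorphism `A + B → A`, which collapses `B` to the unit. -/
def toLeft : HeytingHom (Concat A B) A where
  toFun x := x.1.1
  map_sup' _ _ := rfl
  map_inf' _ _ := rfl
  map_bot' := rfl
  map_himp' x y := by
    by_cases h : x.1.1 ≤ y.1.1
    · rw [himp_of_le h]
      exact (himp_eq_top_iff.2 h).symm
    · rw [himp_of_not_le h]
      rfl

@[simp]
theorem toLeft_inl (a : A) : toLeft (inl a : Concat A B) = a := rfl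

/-- The homomorphism `A + B → A + C` that is the identity on `A` and `f` on `B`. -/
def mapRight (f : HeytingHom B C) : HeytingHom (Concat A B) (Concat A C) where
  toFun x := ⟨(x.1.1, f x.1.2), x.2.imp id fun h => by rw [h, map_bot]⟩
  map_sup' x y := Subtype.ext (Prod.ext rfl (map_sup f _ _))
  map_inf' x y := Subtype.ext (Prod.ext rfl (map_inf f _ _))
  map_bot' := Subtype.ext (Prod.ext rfl (map_bot f))
  map_himp' x y := by
    by_cases h : x.1.1 ≤ y.1.1
    · rw [himp_of_le h]
      refine Eq.trans ?_ (if_pos h).symm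
      exact Subtype.ext (Prod.ext rfl (map_himp f _ _))
    · rw [himp_of_not_le h]
      refine Eq.trans ?_ (if_neg h).symm
      exact Subtype.ext (Prod.ext rfl (map_bot f))

@[simp]
theorem mapRight_inl (f : HeytingHom B C) (a : A) : mapRight f (inl a) = inl a :=
  Subtype.ext (Prod.ext rfl (map_bot f))

theorem mapRight_injective {f : HeytingHom B C} (hf : Function.Injective f) :
    Function.Injective (mapRight f : HeytingHom (Concat A B) (Concat A C)) := fun _ _ h =>
  have h' := Prod.ext_iff.1 (Subtype.ext_iff.1 h)
  Subtype.ext (Prod.ext h'.1 (hf h'.2))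

theorem inl_le_iff {a : A} {x : Concat A B} : inl a ≤ x ↔ a ≤ toLeft x :=
  ⟨fun h => h.1, fun h => ⟨h, bot_le⟩⟩

theorem inl_injective : Function.Injective (inl : A → Concat A B) :=
  Function.LeftInverse.injective toLeft_inl

theorem inl_toLeft_of_le_inl {a : A} {x : Concat A B} (h : x ≤ inl a) : inl (toLeft x) = x :=
  Subtype.ext (Prod.ext rfl (le_bot_iff.1 h.2).symm)

theorem inf_inl (x : Concat A B) (a : A) : x ⊓ inl a = inl (toLeft x ⊓ a) :=
  Subtype.ext (Prod.ext rfl (inf_bot_eq _))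

theorem inl_inf (a b : A) : (inl (a ⊓ b) : Concat A B) = inl a ⊓ inl b :=
  Subtype.ext (Prod.ext rfl (inf_idem _).symm)

theorem inl_sup (a b : A) : (inl (a ⊔ b) : Concat A B) = inl a ⊔ inl b :=
  Subtype.ext (Prod.ext rfl (sup_idem _).symm)

@[simp]
theorem inl_bot : (inl ⊥ : Concat A B) = ⊥ := rfl

theorem compl_eq_inl [Nontrivial A] {x : Concat A B} (h : x ≠ ⊥) : xᶜ = inl (toLeft x)ᶜ := by
  rw [← himp_bot, ← himp_bot]
  refine himp_of_not_le fun hx => h ?_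
  have hx_left : x.1.1 = ⊥ := le_bot_iff.1 hx
  have hx_right : x.1.2 = ⊥ := x.2.resolve_left (hx_left ▸ bot_ne_top)
  exact Subtype.ext (Prod.ext hx_left hx_right)

theorem isGreatest_inl_top : IsGreatest {x : Concat A Bool | x ≠ ⊤} (inl ⊤) := by
  refine ⟨fun h => Bool.false_ne_true (congrArg (fun x => x.1.2) h), fun x hx => ⟨le_top, ?_⟩⟩
  refine (Bool.eq_false_iff.2 fun hx_right => hx (Subtype.ext (Prod.ext ?_ hx_right))).le
  exact x.2.resolve_right (hx_right ▸ top_ne_bot)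

end Concat

/-! ### Interior algebras and modal spans -/

/-- The formula obtained from a modal formula by renaming its variables. -/
def ModalFormula.rename {X : Type u} {Y : Type v} (r : X → Y) : ModalFormula X → ModalFormula Y
  | var x => var (r x)
  | and φ ψ => and (rename r φ) (rename r ψ)
  | or φ ψ => or (rename r φ) (rename r ψ)
  | imp φ ψ => imp (rename r φ) (rename r ψ)
  | neg φ => neg (rename r φ)
  | box φ => box (rename r φ)

theorem ModalFormula.eval_rename {X : Type u} {Y : Type v} {S : Type w} [InteriorAlgebra S]
    (r : X → Y) (a : Y → S) (φ : ModalFormula X) : (φ.rename r).eval a = φ.eval (a ∘ r) := by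
  induction φ with
  | var => rfl
  | and φ ψ h k => simp only [rename, eval, h, k]
  | or φ ψ h k => simp only [rename, eval, h, k]
  | imp φ ψ h k => simp only [rename, eval, h, k]
  | neg φ h => simp only [rename, eval, h]
  | box φ h => simp only [rename, eval, h]

theorem ModalFormula.map_eval {X : Type*} {S : Type u} {T : Type v} [InteriorAlgebra S]
    [InteriorAlgebra T] (f : BoundedLatticeHom S T)
    (hf : ∀ x, f (InteriorAlgebra.box x) = InteriorAlgebra.box (f x)) (a : X → S)
    (φ : ModalFormula X) : f (φ.eval a) = φ.eval (f ∘ a) := by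
  induction φ with
  | var => rfl
  | and φ ψ h k => simp only [eval, map_inf, h, k]
  | or φ ψ h k => simp only [eval, map_sup, h, k]
  | imp φ ψ h k => simp only [eval, map_himp, h, k]
  | neg φ h => simp only [eval, map_compl', h]
  | box φ h => simp only [eval, hf, h]

theorem InteriorVariety.Mem.of_injective {V : InteriorVariety} {S : Type u} {T : Type v}
    [InteriorAlgebra S] [InteriorAlgebra T] (hT : V.Mem T) {f : BoundedLatticeHom S T}
    (hf : ∀ x, f (InteriorAlgebra.box x) = InteriorAlgebra.box (f x))
    (hinj : Function.Injective f) : V.Mem S := fun e he a => hinj <| by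
  rw [ModalFormula.map_eval f hf, ModalFormula.map_eval f hf, hT e he]

theorem InteriorVariety.valid_generatedBy {K : Type u} [InteriorAlgebra K] {X : Type v}
    [Countable X] {φ : ModalFormula X} (h : ∀ a : X → K, φ.eval a = ⊤) :
    InteriorVariety.Valid.{v, w} (generatedBy K) φ := by
  intro S _ hS a
  obtain ⟨r, hr⟩ := exists_injective_nat X
  have h' := hS (φ.rename r, .imp (.var 0) (.var 0))
    (fun b => by rw [ModalFormula.eval_rename, h, ModalFormula.eval, himp_self])
    (Function.extend r a fun _ => ⊤)
  rwa [ModalFormula.eval_rename, Function.extend_comp hr, ModalFormula.eval, himp_self] at h'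

section FreeBooleanExtension

variable {H : Type u} {B : Type v} [HeytingAlgebra H] [BooleanAlgebra B]

/-- The value of a Boolean term under an interpretation of the elements of `H`. -/
def BoolTerm.eval (f : H → B) : BoolTerm H → B
  | of a => f a
  | bot => ⊥
  | top => ⊤
  | inf s t => eval f s ⊓ eval f t
  | sup s t => eval f s ⊔ eval f t
  | compl s => (eval f s)ᶜ

theorem BoolTerm.Le.eval_le (f : BoundedLatticeHom H B) {s t : BoolTerm H}
    (h : BoolTerm.Le s t) : s.eval f ≤ t.eval f := by
  induction h with
  | refl => exact le_rfl
  | trans _ _ h k => exact h.trans k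
  | bot_le => exact _root_.bot_le
  | le_top => exact _root_.le_top
  | inf_left => exact inf_le_left
  | inf_right => exact inf_le_right
  | le_inf _ _ h k => exact _root_.le_inf h k
  | sup_left => exact le_sup_left
  | sup_right => exact le_sup_right
  | sup_le _ _ h k => exact _root_.sup_le h k
  | distrib => exact le_sup_inf
  | inf_compl => exact (_root_.inf_compl_self _).le
  | sup_compl => exact _root_.sup_compl_eq_top.ge
  | compl_anti _ h => exact compl_le_compl h
  | of_bot => exact (map_bot f).le
  | of_top => exact (map_top f).ge
  | of_mono h => exact OrderHomClass.mono f h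
  | of_inf => exact (map_inf f _ _).ge
  | of_sup => exact (map_sup f _ _).le

/-- The unique homomorphism out of the free Boolean extension of `H` that extends `f`. -/
def ModalSpan.lift (f : BoundedLatticeHom H B) : BoundedLatticeHom (ModalSpan H) B where
  toFun := Quotient.lift (BoolTerm.eval f) fun _ _ h =>
    le_antisymm (h.1.eval_le f) (h.2.eval_le f)
  map_sup' := by rintro ⟨s⟩ ⟨t⟩; rfl
  map_inf' := by rintro ⟨s⟩ ⟨t⟩; rfl
  map_top' := rfl
  map_bot' := rfl

end FreeBooleanExtension

namespace ModalSpan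

variable {H : Type u} {L : Type v} [HeytingAlgebra H] [HeytingAlgebra L]

theorem of_injective : Function.Injective (of : H → ModalSpan H) := fun _ _ h =>
  le_antisymm (of_le_of.1 h.le) (of_le_of.1 h.ge)

theorem of_eq_top_iff {a : H} : of a = ⊤ ↔ a = ⊤ := by
  rw [← of_top, of_injective.eq_iff]

theorem box_eq (x : ModalSpan H) : InteriorAlgebra.box x = box x := rfl

theorem box_himp_of (a b : H) : box (of a ⇨ of b) = of (a ⇨ b) := by
  simpa [cnf, impInf, himp_eq, sup_comm] using box_cnf [(a, b)]

theorem box_compl_of (a : H) : box (of a)ᶜ = of aᶜ := by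
  rw [← himp_bot, ← himp_bot, ← of_bot, box_himp_of]

theorem exists_box_eq_of (x : ModalSpan H) : ∃ a : H, box x = of a := ⟨_, rfl⟩

theorem box_eq_top_iff {x : ModalSpan H} : box x = ⊤ ↔ x = ⊤ :=
  ⟨fun h => top_le_iff.1 (h ▸ box_le_self x), fun h => by rw [h, ← of_top, box_of]⟩

/-- The homomorphism of modal spans induced by a homomorphism of Heyting algebras. -/
def map (f : HeytingHom H L) : BoundedLatticeHom (ModalSpan H) (ModalSpan L) :=
  lift
    { toFun := fun a => of (f a)
      map_sup' := fun _ _ => by rw [map_sup, of_sup]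
      map_inf' := fun _ _ => by rw [map_inf, of_inf]
      map_top' := by rw [map_top, of_top]
      map_bot' := by rw [map_bot, of_bot] }

variable (f : HeytingHom H L)

@[simp]
theorem map_of (a : H) : map f (of a) = of (f a) := rfl

theorem map_cnf (l : List (H × H)) : map f (cnf l) = cnf (l.map (Prod.map f f)) := by
  induction l with
  | nil => rfl
  | cons p l ih =>
    change map f (((of p.1)ᶜ ⊔ of p.2) ⊓ cnf l) =
      ((of (f p.1))ᶜ ⊔ of (f p.2)) ⊓ cnf (l.map (Prod.map f f))
    rw [map_inf, map_sup, map_compl', ih, map_of, map_of]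

theorem map_impInf (l : List (H × H)) : f (impInf l) = impInf (l.map (Prod.map f f)) := by
  induction l with
  | nil => exact map_top f
  | cons p l ih =>
    change f ((p.1 ⇨ p.2) ⊓ impInf l) = (f p.1 ⇨ f p.2) ⊓ impInf (l.map (Prod.map f f))
    rw [map_inf, map_himp, ih]

theorem map_box (x : ModalSpan H) :
    map f (InteriorAlgebra.box x) = InteriorAlgebra.box (map f x) := by
  obtain ⟨l, rfl⟩ := exists_cnf x
  rw [box_eq, box_eq, box_cnf, map_cnf, box_cnf, map_of, map_impInf]

variable {f}

theorem map_eq_top_iff {x : ModalSpan H} {a : H} (h : box x = of a) : map f x = ⊤ ↔ f a = ⊤ := by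
  rw [← box_eq_top_iff, ← box_eq, ← map_box, box_eq, h, map_of, of_eq_top_iff]

theorem map_injective (hf : Function.Injective f) : Function.Injective (map f) := by
  have eq_top : ∀ x, map f x = ⊤ → x = ⊤ := fun x hx => by
    obtain ⟨a, ha⟩ := exists_box_eq_of x
    rw [map_eq_top_iff ha, ← map_top f, hf.eq_iff] at hx
    rw [← box_eq_top_iff, ha, hx, of_top]
  intro x y h
  rw [← bihimp_eq_top]
  exact eq_top _ (by rw [map_bihimp, h, bihimp_self])

theorem map_relativize_eq_top_iff {c : H} {x : ModalSpan H} :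
    map (relativize c) x = ⊤ ↔ of c ≤ x := by
  obtain ⟨a, ha⟩ := exists_box_eq_of x
  rw [map_eq_top_iff ha, relativize_eq_top_iff, ← of_le_box, ha, of_le_of]

theorem isSubdirectlyIrreducible {m : H} (hm : IsGreatest {x : H | x ≠ ⊤} m) :
    IsSubdirectlyIrreducible (ModalSpan H) := by
  refine ⟨of m, ⊤, fun h => hm.1 (of_eq_top_iff.1 h), ?_⟩
  have of_not_le : ∀ r : ModalSpan H → ModalSpan H → Prop, IsInteriorCongruence r →
      ∀ x y, r x y → ¬ x ≤ y → r (of m) ⊤ := by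
    intro r hr x y hxy hle
    obtain ⟨a, ha⟩ := exists_box_eq_of (x ⇨ y)
    have ha_le : a ≤ m := hm.2 fun h =>
      hle (himp_eq_top_iff.1 (box_eq_top_iff.1 (ha.trans (of_eq_top_iff.2 h))))
    have hr_a : r (of a) ⊤ := by
      simpa only [himp_self, InteriorAlgebra.box_top, box_eq, ha] using
        hr.box (hr.himp hxy (hr.equivalence.refl y))
    simpa only [← of_sup, sup_eq_left.2 ha_le, sup_top_eq] using
      hr.sup (hr.equivalence.refl (of m)) hr_a
  rintro r hr ⟨x, y, hne, hxy⟩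
  by_cases hle : x ≤ y
  · exact of_not_le r hr y x (hr.equivalence.symm hxy) fun hle' => hne (le_antisymm hle hle')
  · exact of_not_le r hr x y hxy hle

end ModalSpan

/-- The family `a` generates the Heyting algebra `H`: the only subalgebra that contains all `a i`
is `H`. As in `GeneratesInterior`, closure under `ᶜ` stands for the condition `⊥ ∈ T`, which
makes no difference unless `X` is empty. -/
def GeneratesHeyting {X : Type v} {H : Type u} [HeytingAlgebra H] (a : X → H) : Prop :=
  ∀ T : Set H, (∀ i, a i ∈ T) →
    (∀ x ∈ T, ∀ y ∈ T, x ⊓ y ∈ T) → (∀ x ∈ T, ∀ y ∈ T, x ⊔ y ∈ T) →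
    (∀ x ∈ T, ∀ y ∈ T, x ⇨ y ∈ T) → (∀ x ∈ T, xᶜ ∈ T) → T = Set.univ

theorem GeneratesHeyting.generatesInterior {X : Type v} {H : Type u} [HeytingAlgebra H]
    {a : X → H} (h : GeneratesHeyting a) : GeneratesInterior (ModalSpan.of ∘ a) := by
  intro T hT hinf hsup himp hcompl hbox
  have of_mem : ModalSpan.of ⁻¹' T = Set.univ := h _ hT
    (fun x hx y hy => by simpa only [Set.mem_preimage, ModalSpan.of_inf] using hinf _ hx _ hy)
    (fun x hx y hy => by simpa only [Set.mem_preimage, ModalSpan.of_sup] using hsup _ hx _ hy)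
    (fun x hx y hy => by
      rw [Set.mem_preimage, ← ModalSpan.box_himp_of]
      exact hbox _ (himp _ hx _ hy))
    (fun x hx => by
      rw [Set.mem_preimage, ← ModalSpan.box_compl_of]
      exact hbox _ (hcompl _ hx))
  exact Set.eq_univ_of_forall <| ModalSpan.induction (Set.eq_univ_iff_forall.1 of_mem)
    (fun x y hx hy => hinf x hx y hy) hcompl

theorem ModalSpan.definesInterior {H : Type u} {K : Type v} [HeytingAlgebra H] [HeytingAlgebra K]
    {n : ℕ} {φ : ModalFormula (Fin n)} {a : Fin n → ModalSpan H} (hgen : GeneratesInterior a)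
    (hφ : φ.eval a = ⊤)
    (h : ∀ (c : K) (b : Fin n → ModalSpan (Set.Iic c)), φ.eval b = ⊤ →
      ∃ f : HeytingHom H (Set.Iic c), map f ∘ a = b) :
    DefinesInterior.{u, w} (InteriorVariety.generatedBy (ModalSpan K)) φ a := by
  refine ⟨hgen, hφ, fun ψ hψ => InteriorVariety.valid_generatedBy fun b => himp_eq_top_iff.2 ?_⟩
  obtain ⟨c, hc⟩ := exists_box_eq_of (φ.eval b)
  have hφc : φ.eval (map (relativize c) ∘ b) = ⊤ := by
    rw [← ModalFormula.map_eval _ (map_box _), map_relativize_eq_top_iff, ← hc]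
    exact box_le_self _
  obtain ⟨f, hf⟩ := h c _ hφc
  change box (φ.eval b) ≤ ψ.eval b
  rw [hc, ← map_relativize_eq_top_iff, ModalFormula.map_eval _ (map_box _), ← hf,
    ← ModalFormula.map_eval _ (map_box _), hψ, map_top]

/-! ### The Rieger–Nishimura ladder -/

section NishimuraTerm

variable {H : Type u} {L : Type v} [HeytingAlgebra H] [HeytingAlgebra L]

/-- The Nishimura term `¬¬x ∨ (¬¬x → x)`. -/
def nishimura (x : H) : H := xᶜᶜ ⊔ (xᶜᶜ ⇨ x)

theorem map_nishimura (f : HeytingHom H L) (x : H) : f (nishimura x) = nishimura (f x) := by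
  simp only [nishimura, map_sup, map_himp, map_compl]

theorem nishimura_eq_top_of_isRegular {x : H} (h : Heyting.IsRegular x) : nishimura x = ⊤ := by
  rw [nishimura, h.eq, himp_self, sup_top_eq]

theorem nishimura_eq_top_of_compl_eq_bot {x : H} (h : xᶜ = ⊥) : nishimura x = ⊤ := by
  rw [nishimura, h, compl_bot, top_sup_eq]

end NishimuraTerm

section LowerSet

variable {α : Type u} [Preorder α] {U V : LowerSet α} {x : α}

theorem mem_himp_lowerSet : x ∈ U ⇨ V ↔ ∀ y ≤ x, y ∈ U → y ∈ V := by
  rw [← LowerSet.Iic_le, le_himp_iff]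
  exact ⟨fun h y hy hU => h ⟨hy, hU⟩, fun h y hy => h y hy.1 hy.2⟩

theorem mem_compl_lowerSet : x ∈ Uᶜ ↔ ∀ y ≤ x, y ∉ U := by
  rw [← himp_bot, mem_himp_lowerSet]
  rfl

end LowerSet

namespace RiegerNishimura

/-- The generator of the Rieger–Nishimura ladder. -/
def gen : RiegerNishimura := FreeHeyting.of ()

theorem inf_compl_gen_eq (x : RiegerNishimura) : x ⊓ genᶜ = ⊥ ∨ x ⊓ genᶜ = genᶜ := by
  induction x using FreeHeyting.induction with
  | of x => exact .inl (inf_compl_self _)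
  | bot => exact .inl (bot_inf_eq _)
  | inf x y hx hy =>
    rw [inf_inf_distrib_right]
    rcases hx with hx | hx <;> rcases hy with hy | hy <;> simp [hx, hy]
  | sup x y hx hy =>
    rw [inf_sup_right]
    rcases hx with hx | hx <;> rcases hy with hy | hy <;> simp [hx, hy]
  | himp x y hx hy =>
    rw [himp_inf_eq_himp_inf_inf]
    rcases hx with hx | hx <;> rcases hy with hy | hy <;> simp [hx, hy]

theorem inf_compl_compl_gen_eq (x : RiegerNishimura) :
    x ⊓ genᶜᶜ = ⊥ ∨ x ⊓ genᶜᶜ = gen ∨ x ⊓ genᶜᶜ = genᶜᶜ := by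
  have gen_le : gen ≤ genᶜᶜ := le_compl_compl
  have himp_gen_inf : (genᶜᶜ ⇨ gen) ⊓ genᶜᶜ = gen := by
    rw [himp_inf_self, inf_eq_left.2 gen_le]
  induction x using FreeHeyting.induction with
  | of x => exact .inr (.inl (inf_eq_left.2 gen_le))
  | bot => exact .inl (bot_inf_eq _)
  | inf x y hx hy =>
    rw [inf_inf_distrib_right]
    rcases hx with hx | hx | hx <;> rcases hy with hy | hy | hy <;> simp [hx, hy, gen_le]
  | sup x y hx hy =>
    rw [inf_sup_right]
    rcases hx with hx | hx | hx <;> rcases hy with hy | hy | hy <;> simp [hx, hy, gen_le]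
  | himp x y hx hy =>
    rw [himp_inf_eq_himp_inf_inf]
    rcases hx with hx | hx | hx <;> rcases hy with hy | hy | hy <;>
      simp [hx, hy, gen_le, himp_gen_inf]

theorem eq_gen_or_isRegular_or_compl_eq_bot (x : RiegerNishimura) :
    x = gen ∨ Heyting.IsRegular x ∨ xᶜ = ⊥ := by
  rcases inf_compl_gen_eq x with h | h
  · have hx : x ⊓ genᶜᶜ = x := inf_eq_left.2 (disjoint_iff.2 h).le_compl_right
    rcases hx ▸ inf_compl_compl_gen_eq x with h' | h' | h'
    · exact .inr (.inl (h' ▸ Heyting.isRegular_bot))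
    · exact .inl h'
    · exact .inr (.inl (h' ▸ Heyting.isRegular_compl genᶜ))
  · have compl_gen_le : genᶜ ≤ x := inf_eq_right.1 h
    have dense_of_gen_le : gen ≤ x → xᶜ = ⊥ := fun hx =>
      le_bot_iff.1 ((le_inf (compl_le_compl hx) (compl_le_compl compl_gen_le)).trans_eq
        (inf_compl_self _))
    rcases inf_compl_compl_gen_eq x with h' | h' | h'
    · have hx : x = genᶜ := le_antisymm
        (by simpa only [compl_compl_compl] using (disjoint_iff.2 h').le_compl_right) compl_gen_le
      exact .inr (.inl (hx ▸ Heyting.isRegular_compl gen))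
    · exact .inr (.inr (dense_of_gen_le (h' ▸ inf_le_left)))
    · exact .inr (.inr (dense_of_gen_le (le_compl_compl.trans (inf_eq_right.1 h'))))

theorem nishimura_eq_top_of_ne_gen {x : RiegerNishimura} (h : x ≠ gen) : nishimura x = ⊤ :=
  ((eq_gen_or_isRegular_or_compl_eq_bot x).resolve_left h).elim nishimura_eq_top_of_isRegular
    nishimura_eq_top_of_compl_eq_bot

theorem eq_gen_and_eq_bot_of_not_compl_le_nishimura {x y : RiegerNishimura} (hxy : x ≤ yᶜ)
    (h : ¬ yᶜ ≤ nishimura x) : x = gen ∧ y = ⊥ := by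
  obtain rfl : x = gen := by
    by_contra hx
    exact h (nishimura_eq_top_of_ne_gen hx ▸ le_top)
  have y_le : y ≤ genᶜ := le_compl_comm.1 hxy
  rcases inf_compl_gen_eq y with hy | hy
  · exact ⟨rfl, (inf_eq_left.2 y_le).symm.trans hy⟩
  · exact absurd ((compl_le_compl (inf_eq_right.1 hy)).trans le_sup_left) h

theorem eq_of_not_compl_le_nishimura {x y : RiegerNishimura × Bool} (hxy : x ≤ yᶜ)
    (h : ¬ yᶜ ≤ nishimura x) (hy : y ≠ ⊥) : x = (gen, false) ∧ y = (⊥, true) := by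
  obtain ⟨x, i⟩ := x
  obtain ⟨y, j⟩ := y
  have hi : i ≤ jᶜ := hxy.2
  have nishimura_right : nishimura i = ⊤ := nishimura_eq_top_of_isRegular (compl_compl i)
  obtain ⟨rfl, rfl⟩ := eq_gen_and_eq_bot_of_not_compl_le_nishimura hxy.1
    fun h' => h ⟨h', le_top.trans_eq nishimura_right.symm⟩
  obtain rfl : j = true := by
    by_contra hj
    exact hy (Prod.ext rfl (Bool.eq_false_iff.2 hj))
  exact ⟨Prod.ext rfl (le_bot_iff.1 hi), rfl⟩

/-- The points of the Kripke frame of the Rieger–Nishimura ladder: the point of rank `m` lies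
strictly below the point of rank `n` if and only if `m + 2 ≤ n`. Truth sets are lower sets, and
the generator holds at the point of rank `0` only. -/
structure Point where
  rank : ℕ

instance : PartialOrder Point where
  le x y := x.rank = y.rank ∨ x.rank + 2 ≤ y.rank
  le_refl _ := .inl rfl
  le_trans _ _ _ := by omega
  le_antisymm x y h k := by
    cases x
    cases y
    simp only [Point.mk.injEq] at *
    omega

theorem Point.le_iff {x y : Point} : x ≤ y ↔ x.rank = y.rank ∨ x.rank + 2 ≤ y.rank := Iff.rfl

/-- The set of the points whose rank is less than `n`. -/
def initial (n : ℕ) : LowerSet Point where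
  carrier := {x | x.rank < n}
  lower' x y h hx := by
    simp only [Point.le_iff, Set.mem_ofPred_eq] at h hx ⊢
    omega

theorem mem_initial {n : ℕ} {x : Point} : x ∈ initial n ↔ x.rank < n := Iff.rfl

theorem initial_injective : Function.Injective initial := fun m n h => by
  have lt_iff (k : ℕ) : k < m ↔ k < n := SetLike.ext_iff.1 h ⟨k⟩
  exact eq_of_forall_lt_iff lt_iff

theorem initial_add_two (n : ℕ) :
    initial (n + 2) = initial (n + 1) ⊔ (initial (n + 1) ⇨ initial n) := by
  ext x
  simp only [SetLike.mem_coe, LowerSet.mem_sup_iff, mem_himp_lowerSet, mem_initial]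
  constructor
  · refine fun hx => or_iff_not_imp_left.2 fun hx' y hyx hy => ?_
    rw [Point.le_iff] at hyx
    omega
  · rintro (hx | hx)
    · omega
    · by_contra hx'
      exact lt_irrefl n (hx ⟨n⟩ (Point.le_iff.2 (.inr (by simp only; omega))) n.lt_succ_self)

/-- The homomorphism that evaluates an element of the ladder in its Kripke frame. -/
def truthSet : HeytingHom RiegerNishimura (LowerSet Point) := FreeHeyting.lift fun _ => initial 1

theorem initial_mem_range_truthSet (n : ℕ) : initial n ∈ Set.range truthSet := by
  induction n using Nat.twoStepInduction with
  | zero =>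
    refine ⟨⊥, (map_bot truthSet).trans (SetLike.ext fun x => ?_)⟩
    exact iff_of_false id (Nat.not_lt_zero _)
  | one => exact ⟨gen, rfl⟩
  | more n hn hn' =>
    obtain ⟨x, hx⟩ := hn
    obtain ⟨y, hy⟩ := hn'
    exact ⟨y ⊔ (y ⇨ x), by rw [map_sup, map_himp, hx, hy, initial_add_two]⟩

instance : Infinite RiegerNishimura := by
  choose x hx using initial_mem_range_truthSet
  refine Infinite.of_injective x fun m n h => initial_injective ?_
  rw [← hx m, ← hx n, h]

theorem nishimura_gen_ne_top : nishimura gen ≠ ⊤ := by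
  intro h
  have mem_nishimura : (⟨4⟩ : Point) ∈ nishimura (initial 1) := by
    change _ ∈ nishimura (truthSet gen)
    rw [← map_nishimura, h, map_top]
    exact LowerSet.mem_top
  have one_mem : (⟨1⟩ : Point) ∈ (initial 1)ᶜ :=
    mem_compl_lowerSet.2 fun y hy => by
      simp only [Point.le_iff, mem_initial] at hy ⊢
      omega
  have two_mem : (⟨2⟩ : Point) ∈ (initial 1)ᶜᶜ :=
    mem_compl_lowerSet.2 fun y hy hy' => by
      have zero_le : (⟨0⟩ : Point) ≤ y := by
        simp only [Point.le_iff] at hy ⊢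
        omega
      exact mem_compl_lowerSet.1 hy' ⟨0⟩ zero_le Nat.zero_lt_one
  rcases mem_nishimura with four_mem | four_mem
  · exact mem_compl_lowerSet.1 four_mem ⟨1⟩ (Point.le_iff.2 (.inr (by decide))) one_mem
  · have two_mem' := mem_himp_lowerSet.1 four_mem ⟨2⟩ (Point.le_iff.2 (.inr le_rfl)) two_mem
    exact absurd (mem_initial.1 two_mem') (by decide)

end RiegerNishimura

/-! ### The presentation of `Z × Z₂ + Z₂` -/

/-- The relations between the generators `(g, 0)` and `(1, 0)` of `Z × Z₂ + Z₂`. -/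
structure IsLadderPair {L : Type u} [HeytingAlgebra L] (p q : L) : Prop where
  le : p ≤ q
  isRegular : Heyting.IsRegular q
  himp_nishimura_le : q ⇨ nishimura p ≤ q ⊔ qᶜ

namespace ModalSpan

variable {H : Type u} [HeytingAlgebra H]

theorem mem_range_of_iff {x : ModalSpan H} : x ∈ Set.range of ↔ x ≤ box x := by
  constructor
  · rintro ⟨a, rfl⟩
    exact (box_of a).ge
  · intro h
    obtain ⟨a, ha⟩ := exists_box_eq_of x
    exact ⟨a, ha.symm.trans (le_antisymm (box_le_self x) h)⟩

end ModalSpan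

namespace ModalFormula

variable {X : Type u}

/-- The formula stating that the value of `φ` is open. -/
def isOpen (φ : ModalFormula X) : ModalFormula X := imp φ (box φ)

/-- The modal translation of intuitionistic negation. -/
def hneg (φ : ModalFormula X) : ModalFormula X := box (neg φ)

/-- The modal translation of the Nishimura term. -/
def nishimura (φ : ModalFormula X) : ModalFormula X :=
  or (hneg (hneg φ)) (box (imp (hneg (hneg φ)) φ))

/-- The formula stating that the values of its two variables are open and form a ladder pair. -/
def ladderPresentation : ModalFormula (Fin 2) :=
  and (and (isOpen (var 0)) (isOpen (var 1)))
    (and (and (imp (var 0) (var 1)) (imp (hneg (hneg (var 1))) (var 1)))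
      (imp (box (imp (var 1) (nishimura (var 0)))) (or (var 1) (hneg (var 1)))))

open ModalSpan

theorem eval_ladderPresentation_of {L : Type v} [HeytingAlgebra L] {p q : L} :
    ladderPresentation.eval (of ∘ ![p, q]) = ⊤ ↔ IsLadderPair p q := by
  simp only [ladderPresentation, isOpen, hneg, nishimura, eval, Function.comp_apply,
    Matrix.cons_val_zero, Matrix.cons_val_one, box_eq, box_compl_of, box_himp_of, box_of, ← of_sup,
    inf_eq_top_iff, himp_eq_top_iff, of_le_of, le_refl, true_and]
  exact ⟨fun ⟨⟨hle, hreg⟩, h⟩ => ⟨hle, le_antisymm hreg le_compl_compl, h⟩,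
    fun h => ⟨⟨h.le, h.isRegular.le⟩, h.himp_nishimura_le⟩⟩

theorem exists_isLadderPair_of_eval_eq_top {L : Type v} [HeytingAlgebra L]
    {a : Fin 2 → ModalSpan L} (h : ladderPresentation.eval a = ⊤) :
    ∃ p q, a = of ∘ ![p, q] ∧ IsLadderPair p q := by
  have hopen := h
  simp only [ladderPresentation, isOpen, eval, inf_eq_top_iff, himp_eq_top_iff, box_eq,
    ← mem_range_of_iff] at hopen
  obtain ⟨⟨⟨p, hp⟩, q, hq⟩, -⟩ := hopen
  obtain rfl : a = of ∘ ![p, q] := by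
    funext i
    fin_cases i
    exacts [hp.symm, hq.symm]
  exact ⟨p, q, rfl, eval_ladderPresentation_of.1 h⟩

end ModalFormula

namespace ZStar

open RiegerNishimura Concat

variable {A : Type u} [HeytingAlgebra A]

/-- The element `(g, 0)` of `Z × Z₂ + A`, where `g` is the generator of `Z`. -/
noncomputable def ladderGen : ZStar A := inl (gen, false)

/-- The element `(1, 0)` of `Z × Z₂ + A`, the top of the ladder. -/
noncomputable def ladderTop : ZStar A := inl (⊤, false)

theorem compl_ladderTop : (ladderTop : ZStar A)ᶜ = inl (⊥, true) := by
  have h : (ladderTop : ZStar A) ≠ ⊥ := fun h =>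
    top_ne_bot (congrArg (fun x => (toLeft x).1) h)
  rw [compl_eq_inl h]
  exact congrArg inl (Prod.ext compl_top rfl)

theorem isRegular_ladderTop : Heyting.IsRegular (ladderTop : ZStar A) := by
  have h : (inl (⊥, true) : ZStar A) ≠ ⊥ := fun h =>
    Bool.false_ne_true.symm (congrArg (fun x => (toLeft x).2) h)
  rw [Heyting.IsRegular, compl_ladderTop, compl_eq_inl h]
  exact congrArg inl (Prod.ext compl_bot rfl)

theorem isLadderPair_gens : IsLadderPair (ladderGen : ZPrime) ladderTop where
  le := inl_le_iff.2 ⟨le_top, le_rfl⟩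
  isRegular := isRegular_ladderTop
  himp_nishimura_le := by
    have sup_compl : (ladderTop : ZPrime) ⊔ ladderTopᶜ = inl ⊤ := by
      rw [compl_ladderTop, ladderTop, ← inl_sup]
      exact congrArg inl (Prod.ext (top_sup_eq _) rfl)
    rw [sup_compl]
    refine isGreatest_inl_top.2 fun h => nishimura_gen_ne_top (top_le_iff.1 ?_)
    have hle : (⊤, false) ≤ toLeft (nishimura (ladderGen : ZPrime)) :=
      inl_le_iff.1 (himp_eq_top_iff.1 h)
    rw [map_nishimura] at hle
    exact hle.1

theorem inl_mk_false_mem {T : Set ZPrime} (hgen : ladderGen ∈ T) (htop : ladderTop ∈ T)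
    (hinf : ∀ x ∈ T, ∀ y ∈ T, x ⊓ y ∈ T) (hsup : ∀ x ∈ T, ∀ y ∈ T, x ⊔ y ∈ T)
    (himp : ∀ x ∈ T, ∀ y ∈ T, x ⇨ y ∈ T) (hcompl : ∀ x ∈ T, xᶜ ∈ T) (z : RiegerNishimura) :
    inl (z, false) ∈ T := by
  induction z using FreeHeyting.induction with
  | of => exact hgen
  | bot =>
    change (inl ⊥ : ZPrime) ∈ T
    rw [inl_bot, ← inf_compl_self ladderTop]
    exact hinf _ htop _ (hcompl _ htop)
  | inf x y hx hy => exact inl_inf (B := Bool) (x, false) (y, false) ▸ hinf _ hx _ hy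
  | sup x y hx hy => exact inl_sup (B := Bool) (x, false) (y, false) ▸ hsup _ hx _ hy
  | himp x y hx hy =>
    have eq : (inl (x ⇨ y, false) : ZPrime) =
        (inl (x, false) ⇨ inl (y, false)) ⊓ ladderTop := by
      rw [ladderTop, inf_inl, map_himp, toLeft_inl, toLeft_inl]
      exact congrArg inl (Prod.ext (inf_top_eq _).symm rfl)
    exact eq ▸ hinf _ (himp _ hx _ hy) _ htop

theorem generatesHeyting_gens : GeneratesHeyting ![(ladderGen : ZPrime), ladderTop] := by
  intro T hT hinf hsup himp hcompl
  have inl_false_mem := inl_mk_false_mem (hT 0) (hT 1) hinf hsup himp hcompl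
  have inl_mem : ∀ y, inl y ∈ T := by
    rintro ⟨z, _ | _⟩
    · exact inl_false_mem z
    · have eq : (inl (z, true) : ZPrime) = inl (z, false) ⊔ ladderTopᶜ := by
        rw [compl_ladderTop, ← inl_sup]
        exact congrArg inl (Prod.ext (sup_bot_eq _).symm rfl)
      exact eq ▸ hsup _ (inl_false_mem z) _ (hcompl _ (hT 1))
  refine Set.eq_univ_of_forall fun z => ?_
  by_cases hz : z = ⊤
  · rw [hz, ← himp_self (a := ladderGen)]
    exact himp _ (hT 0) _ (hT 0)
  · rw [← inl_toLeft_of_le_inl (isGreatest_inl_top.2 hz)]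
    exact inl_mem _

theorem eq_relativize_of_isLadderPair {c : ZStar A} {p q : Set.Iic c} (h : IsLadderPair p q)
    (hne : q ⊔ qᶜ ≠ ⊤) : p = relativize c ladderGen ∧ q = relativize c ladderTop := by
  have coe_ne_bot : ∀ {x : Set.Iic c}, x ≠ ⊥ → x.1 ≠ ⊥ := fun hx hx' => hx (Subtype.ext hx')
  have q_ne_bot : q.1 ≠ ⊥ := coe_ne_bot fun hq => hne (by rw [hq, compl_bot, sup_top_eq])
  have compl_ne_bot : (qᶜ).1 ≠ ⊥ :=
    coe_ne_bot fun hq => hne (by rw [← h.isRegular.eq, hq, compl_bot, top_sup_eq])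
  have compl_le : (qᶜ).1 ≤ inl (toLeft q.1)ᶜ := by
    rw [← compl_eq_inl q_ne_bot]
    exact inf_le_left
  set r := toLeft (qᶜ).1
  have inl_r : inl r = (qᶜ).1 := inl_toLeft_of_le_inl compl_le
  have q_eq : q = relativize c (inl rᶜ) := by
    rw [← compl_eq_inl compl_ne_bot, ← compl_eq_relativize, h.isRegular.eq]
  have p_le : p.1 ≤ inl rᶜ :=
    (show p.1 ≤ q.1 from h.le).trans ((congrArg Subtype.val q_eq).trans_le inf_le_left)
  have inl_toLeft_p : inl (toLeft p.1) = p.1 := inl_toLeft_of_le_inl p_le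
  have not_le : ¬ rᶜ ≤ nishimura (toLeft p.1) := fun hle => by
    have q_le : q ≤ nishimura p := by
      rw [q_eq, ← relativize_coe p, ← map_nishimura]
      exact OrderHomClass.mono _ (inl_le_iff.2 (hle.trans_eq (map_nishimura toLeft _).symm))
    exact hne (top_le_iff.1 ((himp_eq_top_iff.2 q_le).ge.trans h.himp_nishimura_le))
  have r_ne_bot : r ≠ ⊥ := fun hr' => compl_ne_bot (by rw [← inl_r, hr', inl_bot])
  obtain ⟨p_left, r_eq⟩ :=
    eq_of_not_compl_le_nishimura (inl_le_iff.1 (inl_toLeft_p.trans_le p_le)) not_le r_ne_bot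
  constructor
  · rw [ladderGen, ← p_left, inl_toLeft_p, relativize_coe]
  · rw [q_eq, r_eq, ladderTop]
    exact congrArg (fun x => relativize c (inl x)) (Prod.ext compl_bot rfl)

theorem exists_hom_of_isLadderPair {c : ZStar A} {p q : Set.Iic c} (h : IsLadderPair p q) :
    ∃ f : HeytingHom ZPrime (Set.Iic c), f ladderGen = p ∧ f ladderTop = q := by
  by_cases hq : q ⊔ qᶜ = ⊤
  · have hc : IsCompl q qᶜ := ⟨disjoint_compl_right, codisjoint_iff.2 hq⟩
    refine ⟨(splitHom (FreeHeyting.lift fun _ => p) (boolHom _) hc).comp toLeft, ?_, ?_⟩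
    · change p ⊓ q ⊔ ⊥ ⊓ qᶜ = p
      rw [bot_inf_eq, sup_bot_eq, inf_eq_left.2 h.le]
    · change FreeHeyting.lift _ ⊤ ⊓ q ⊔ ⊥ ⊓ qᶜ = q
      rw [map_top, top_inf_eq, bot_inf_eq, sup_bot_eq]
  · obtain ⟨hp, hq⟩ := eq_relativize_of_isLadderPair h hq
    exact ⟨(relativize c).comp (mapRight (boolHom A)),
      (congrArg _ (mapRight_inl _ _)).trans hp.symm,
      (congrArg _ (mapRight_inl _ _)).trans hq.symm⟩

theorem definesInterior (A : Type u) [HeytingAlgebra A] :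
    DefinesInterior.{0, w} (InteriorVariety.generatedBy (ModalSpan (ZStar A)))
      ModalFormula.ladderPresentation (ModalSpan.of ∘ ![(ladderGen : ZPrime), ladderTop]) := by
  refine ModalSpan.definesInterior generatesHeyting_gens.generatesInterior
    (ModalFormula.eval_ladderPresentation_of.2 isLadderPair_gens) fun c b hb => ?_
  obtain ⟨p, q, rfl, hpq⟩ := ModalFormula.exists_isLadderPair_of_eval_eq_top hb
  obtain ⟨f, rfl, rfl⟩ := exists_hom_of_isLadderPair hpq
  refine ⟨f, funext fun i => ?_⟩
  fin_cases i <;> rfl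

theorem finitelyPresentableOver (A : Type u) [HeytingAlgebra A] [Nontrivial A] :
    FinitelyPresentableOver.{0, w}
      (InteriorVariety.generatedBy (ModalSpan (ZStar A))) (ModalSpan ZPrime) :=
  ⟨(InteriorVariety.mem_generatedBy (ModalSpan (ZStar A))).of_injective (ModalSpan.map_box _)
      (ModalSpan.map_injective (mapRight_injective boolHom_injective)),
    2, _, _, definesInterior A⟩

end ZStar

theorem theorem7p3 :
    (∀ (A : Type u) [HeytingAlgebra A] [Nontrivial A],
      FinitelyPresentableOver.{0, w}
        (InteriorVariety.generatedBy (ModalSpan (ZStar A))) (ModalSpan ZPrime)) ∧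
    (Infinite (ModalSpan ZPrime) ∧ IsSubdirectlyIrreducible (ModalSpan ZPrime) ∧
      FinitelyPresentableOver.{0, w}
        (InteriorVariety.generatedBy (ModalSpan ZPrime)) (ModalSpan ZPrime)) := by
  refine ⟨fun A => ZStar.finitelyPresentableOver A, ?_,
    ModalSpan.isSubdirectlyIrreducible Concat.isGreatest_inl_top,
    ZStar.finitelyPresentableOver Bool⟩
  exact .of_injective (fun z => ModalSpan.of (Concat.inl (z, false)))
    (ModalSpan.of_injective.comp (Concat.inl_injective.comp (Prod.mk_left_injective false)))
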